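/- Let $\mu>0$ and put $\ln_\mu(x)=\ln(1+\mu+x)$ for $x\in[0,1]$. For $n\ge 1$, $f\in C([0,1])$ and $x\in[0,1]$ let $$a_n(x)=\frac{\ln(1+\mu+\frac{x}{n})-\ln(1+\mu)}{\ln(1+\mu+\frac1n)-\ln(1+\mu)},\qquad \mathscr L_n(f,x)=\ln_\mu(x)\sum_{k=0}^n f\!\left(\tfrac kn\right)\frac{1}{\ln_\mu(k/n)}\binom nk a_n(x)^k(1-a_n(x))^{n-k},$$ and write $f_\mu=f/\ln_\mu$. Let $f\in C([0,1])$ be fixed. Then $$|\mathscr L_n(f,x)-f(x)|=o(n^{-1})\quad (n\to\infty)\qquad\text{for every } 0<x<1$$ (pointwise in $x$) if and only if $f$ is a classical solution of $$f_\mu'(x)+(1+\mu)f_\mu''(x)=0,\qquad 0<x<1,$$ that is, $f$ is twice continuously differentiable on $(0,1)$ and satisfies the equation at every point of $(0,1)$. Moreover, $f$ is such a classical solution if and only if there are $A,B\in\mathbb R$ with $$f(x)=A\,\ln_\mu(x)+B\,\ln_\mu(x)\,e^{-x/(1+\mu)}\qquad\text{for all } x\in[0,1].$$ -/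

import Mathlib

open Filter Set Asymptotics

noncomputable section

namespace LogBernstein

/-- The function `ln_μ(x) = ln(1 + μ + x)`. -/
def lnMu (μ x : ℝ) : ℝ := Real.log (1 + μ + x)

/-- The quotient `f_μ = f / ln_μ`. -/
def quot (μ : ℝ) (f : ℝ → ℝ) (x : ℝ) : ℝ := f x / lnMu μ x

/-- The binomial weight `p_{n,k}(x) = C(n,k) x^k (1-x)^(n-k)`. -/
def weight (n k : ℕ) (x : ℝ) : ℝ := (bernsteinPolynomial ℝ n k).eval x

/-- The weight written out explicitly. -/
theorem weight_eq (n k : ℕ) (x : ℝ) :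
    weight n k x = (n.choose k : ℝ) * x ^ k * (1 - x) ^ (n - k) := by
  simp [weight, bernsteinPolynomial]

/-- The function
`a_n(x) = (ln(1 + μ + x/n) - ln(1 + μ)) / (ln(1 + μ + 1/n) - ln(1 + μ))`, for `n ≥ 1`. -/
def node (μ : ℝ) (n : ℕ) (x : ℝ) : ℝ :=
  (Real.log (1 + μ + x / n) - Real.log (1 + μ)) /
    (Real.log (1 + μ + 1 / n) - Real.log (1 + μ))

/-- The Bernstein-type logarithmic operator
`L_n(f,x) = ln_μ(x) ∑_{k=0}^n f(k/n) (1 / ln_μ(k/n)) p_{n,k}(a_n(x))`, for `n ≥ 1`. -/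
def logOp (μ : ℝ) (n : ℕ) (f : ℝ → ℝ) (x : ℝ) : ℝ :=
  lnMu μ x * ∑ k ∈ Finset.range (n + 1),
    f ((k : ℝ) / n) * (1 / lnMu μ ((k : ℝ) / n)) * weight n k (node μ n x)

/-- `f` is a classical solution of `f_μ' + (1 + μ) f_μ'' = 0` on `(0,1)`: it is twice continuously
differentiable there and satisfies the equation at every point. -/
def IsClassicalSolution (μ : ℝ) (f : ℝ → ℝ) : Prop :=
  ContDiffOn ℝ 2 f (Ioo 0 1) ∧
    ∀ x ∈ Ioo (0 : ℝ) 1, deriv (quot μ f) x + (1 + μ) * deriv (deriv (quot μ f)) x = 0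

end LogBernstein

end

/-! Dividing by `ln_μ` turns the claim into one about `g = f_μ` and `L n g x`, the Bernstein
polynomial of `g` at `a_n(x)`. These operators are positive and reproduce constants, and
`n (a_n(x) - x) → x (1 - x) / (2 (1 + μ)) > 0`, so `L n φ - φ ≥ c / n` at each interior point for
the test function `φ(x) = x`. A function `u` with `L n u - u = o(1/n)` therefore obeys the maximum
principle: an interior maximum of `u + ε φ` would force `L n u - u ≤ -ε c / n` there. The error is
`o(1/n)` for constants and for `exp (-x / (1 + μ))`, the latter because `log (1 + s)` and
`1 - exp (-s)` agree to second order at `0`. By the maximum principle every `g` with this rate is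
the combination of these two functions with the same boundary values, and their combinations are
exactly the solutions of `g' + (1 + μ) g'' = 0`. -/

open scoped Topology

namespace LogBernstein

section MaximumPrinciple

variable {ι X : Type*} [TopologicalSpace X] {l : Filter ι} [l.NeBot] {K U : Set X}
  {L : ι → X → (X → ℝ) →ₗ[ℝ] ℝ} {r : ι → ℝ} {φ : X → ℝ}

theorem nonpos_of_isLittleO_of_nonpos_sdiff (hK : IsCompact K)
    (hL : ∀ i, ∀ x ∈ K, ∀ g : X → ℝ, IsMaxOn g K x → L i x g ≤ g x)
    (hr : ∀ᶠ i in l, 0 < r i) (hφ : ContinuousOn φ K)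
    (hφL : ∀ x ∈ U, ∃ c > 0, ∀ᶠ i in l, c * r i ≤ L i x φ - φ x)
    {u : X → ℝ} (hu : ContinuousOn u K)
    (huL : ∀ x ∈ U, (fun i => L i x u - u x) =o[l] r) (hub : ∀ x ∈ K \ U, u x ≤ 0) :
    ∀ x ∈ K, u x ≤ 0 := by
  intro y hy
  by_contra! hpos
  obtain ⟨w, -, hφmax⟩ := hK.exists_isMaxOn ⟨y, hy⟩ hφ
  have hφw : 0 ≤ φ w - φ y := sub_nonneg.2 (hφmax hy)
  -- `ε` is so small that the perturbation `ε φ` cannot move the maximum to the boundary.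
  obtain ⟨ε, hε, hεu⟩ : ∃ ε > 0, ε * (φ w - φ y) < u y :=
    ⟨u y / (φ w - φ y + 1), by positivity, by
      rw [div_mul_eq_mul_div, div_lt_iff₀ (by positivity)]
      nlinarith⟩
  obtain ⟨z, hz, hmax⟩ := hK.exists_isMaxOn ⟨y, hy⟩ (hu.add (hφ.const_smul ε))
  have hzU : z ∈ U := by
    by_contra hzU
    have hyz : u y + ε * φ y ≤ u z + ε * φ z := hmax hy
    have hzw : ε * φ z ≤ ε * φ w := mul_le_mul_of_nonneg_left (hφmax hz) hε.le
    linarith [hub z ⟨hz, hzU⟩]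
  obtain ⟨c, hc, hcφ⟩ := hφL z hzU
  obtain ⟨i, hri, hφi, hui⟩ :=
    (hr.and (hcφ.and ((huL z hzU).def (by positivity : 0 < ε * c / 2)))).exists
  have hLi : L i z u + ε * L i z φ ≤ u z + ε * φ z := by
    simpa using hL i z hz (u + ε • φ) hmax
  rw [Real.norm_eq_abs, Real.norm_of_nonneg hri.le] at hui
  have hgain : ε * (c * r i) ≤ ε * (L i z φ - φ z) := mul_le_mul_of_nonneg_left hφi hε.le
  have hpos' : 0 < ε * (c * r i) := by positivity
  linarith [neg_le_of_abs_le hui]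

theorem le_of_isLittleO_of_le_sdiff (hK : IsCompact K)
    (hL : ∀ i, ∀ x ∈ K, ∀ g : X → ℝ, IsMaxOn g K x → L i x g ≤ g x)
    (hr : ∀ᶠ i in l, 0 < r i) (hφ : ContinuousOn φ K)
    (hφL : ∀ x ∈ U, ∃ c > 0, ∀ᶠ i in l, c * r i ≤ L i x φ - φ x)
    {g h : X → ℝ} (hg : ContinuousOn g K) (hh : ContinuousOn h K)
    (hgL : ∀ x ∈ U, (fun i => L i x g - g x) =o[l] r)
    (hhL : ∀ x ∈ U, (fun i => L i x h - h x) =o[l] r) (hgh : ∀ x ∈ K \ U, g x ≤ h x) :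
    ∀ x ∈ K, g x ≤ h x := by
  suffices ∀ x ∈ K, (g - h) x ≤ 0 from fun x hx => sub_nonpos.1 (this x hx)
  refine nonpos_of_isLittleO_of_nonpos_sdiff hK hL hr hφ hφL (hg.sub hh) (fun x hx => ?_)
    fun x hx => sub_nonpos.2 (hgh x hx)
  refine ((hgL x hx).sub (hhL x hx)).congr_left fun i => ?_
  rw [map_sub, Pi.sub_apply]
  ring

theorem eqOn_of_isLittleO_of_eqOn_sdiff (hK : IsCompact K)
    (hL : ∀ i, ∀ x ∈ K, ∀ g : X → ℝ, IsMaxOn g K x → L i x g ≤ g x)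
    (hr : ∀ᶠ i in l, 0 < r i) (hφ : ContinuousOn φ K)
    (hφL : ∀ x ∈ U, ∃ c > 0, ∀ᶠ i in l, c * r i ≤ L i x φ - φ x)
    {g h : X → ℝ} (hg : ContinuousOn g K) (hh : ContinuousOn h K)
    (hgL : ∀ x ∈ U, (fun i => L i x g - g x) =o[l] r)
    (hhL : ∀ x ∈ U, (fun i => L i x h - h x) =o[l] r) (hgh : EqOn g h (K \ U)) :
    EqOn g h K := fun x hx =>
  le_antisymm
    (le_of_isLittleO_of_le_sdiff hK hL hr hφ hφL hg hh hgL hhL (fun _ hy => (hgh hy).le) x hx)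
    (le_of_isLittleO_of_le_sdiff hK hL hr hφ hφL hh hg hhL hgL (fun _ hy => (hgh hy).ge) x hx)

end MaximumPrinciple

section Bernstein

variable {n : ℕ} {t : ℝ}

/-- The Bernstein polynomial `B_n(g, t) = ∑_{k=0}^n p_{n,k}(t) g(k/n)` at a fixed point `t`, as a
linear functional of `g`. -/
noncomputable def bernsteinSum (n : ℕ) (t : ℝ) : (ℝ → ℝ) →ₗ[ℝ] ℝ :=
  ∑ k ∈ Finset.range (n + 1), weight n k t • LinearMap.proj ((k : ℝ) / n)

theorem bernsteinSum_apply (n : ℕ) (t : ℝ) (g : ℝ → ℝ) :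
    bernsteinSum n t g = ∑ k ∈ Finset.range (n + 1), weight n k t * g (k / n) := by
  simp [bernsteinSum]

theorem weight_nonneg (n k : ℕ) (ht : t ∈ Icc (0 : ℝ) 1) : 0 ≤ weight n k t := by
  have ht0 : 0 ≤ t := ht.1
  have ht1 : 0 ≤ 1 - t := sub_nonneg.2 ht.2
  rw [weight_eq]
  positivity

theorem sum_weight (n : ℕ) (t : ℝ) : ∑ k ∈ Finset.range (n + 1), weight n k t = 1 := by
  simpa [weight, Polynomial.eval_finsetSum] using
    congrArg (Polynomial.eval t) (bernsteinPolynomial.sum ℝ n)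

theorem sum_weight_mul_natCast (n : ℕ) (t : ℝ) :
    ∑ k ∈ Finset.range (n + 1), weight n k t * k = n * t := by
  simpa [weight, Polynomial.eval_finsetSum, mul_comm] using
    congrArg (Polynomial.eval t) (bernsteinPolynomial.sum_smul ℝ n)

theorem natCast_div_mem_Icc {k : ℕ} (hk : k ∈ Finset.range (n + 1)) :
    (k : ℝ) / n ∈ Icc (0 : ℝ) 1 := by
  have : (k : ℝ) ≤ n := by exact_mod_cast Nat.lt_succ_iff.1 (Finset.mem_range.1 hk)
  exact ⟨by positivity, div_le_one_of_le₀ this (by positivity)⟩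

theorem bernsteinSum_congr {g h : ℝ → ℝ} (hgh : EqOn g h (Icc 0 1)) :
    bernsteinSum n t g = bernsteinSum n t h := by
  simp only [bernsteinSum_apply]
  exact Finset.sum_congr rfl fun k hk => by rw [hgh (natCast_div_mem_Icc hk)]

theorem bernsteinSum_le {g : ℝ → ℝ} {M : ℝ} (ht : t ∈ Icc (0 : ℝ) 1)
    (hg : ∀ y ∈ Icc (0 : ℝ) 1, g y ≤ M) : bernsteinSum n t g ≤ M :=
  calc bernsteinSum n t g
      = ∑ k ∈ Finset.range (n + 1), weight n k t * g (k / n) := bernsteinSum_apply n t g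
    _ ≤ ∑ k ∈ Finset.range (n + 1), weight n k t * M := by
        gcongr with k hk
        · exact weight_nonneg n k ht
        · exact hg _ (natCast_div_mem_Icc hk)
    _ = M := by rw [← Finset.sum_mul, sum_weight, one_mul]

theorem bernsteinSum_const (n : ℕ) (t a : ℝ) : bernsteinSum n t (fun _ => a) = a := by
  rw [bernsteinSum_apply, ← Finset.sum_mul, sum_weight, one_mul]

theorem bernsteinSum_id (hn : n ≠ 0) (t : ℝ) : bernsteinSum n t id = t := by
  have hn' : (n : ℝ) ≠ 0 := Nat.cast_ne_zero.2 hn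
  simp only [bernsteinSum_apply, id, ← mul_div_assoc, ← Finset.sum_div, sum_weight_mul_natCast]
  exact mul_div_cancel_left₀ t hn'

theorem bernsteinSum_exp_neg_div (n : ℕ) (t c : ℝ) :
    bernsteinSum n t (fun y => Real.exp (-y / c)) =
      (1 - t * (1 - Real.exp (-(c * n)⁻¹))) ^ n := by
  have hsum : 1 - t * (1 - Real.exp (-(c * n)⁻¹)) = t * Real.exp (-(c * n)⁻¹) + (1 - t) := by ring
  rw [hsum, add_pow, bernsteinSum_apply]
  refine Finset.sum_congr rfl fun k _ => ?_
  have hexp : Real.exp (-(k / n) / c) = Real.exp (-(c * n)⁻¹) ^ k := by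
    rw [← Real.exp_nat_mul, mul_inv]
    ring_nf
  rw [weight_eq, hexp]
  ring

end Bernstein

section LogRatio

variable {x s : ℝ}

/-- The ratio `log (1 + x s) / log (1 + s)`, which is the node `a_n(x)` when
`s = 1 / ((1 + μ) n)`; it turns limits in `n` into limits in a real variable `s → 0`. -/
noncomputable def logRatio (x s : ℝ) : ℝ := Real.log (1 + x * s) / Real.log (1 + s)

theorem logRatio_mem_Icc (hx : x ∈ Icc (0 : ℝ) 1) (hs : 0 ≤ s) : logRatio x s ∈ Icc (0 : ℝ) 1 := by
  have hxs : 0 ≤ x * s := mul_nonneg hx.1 hs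
  have hlog : 0 ≤ Real.log (1 + s) := Real.log_nonneg (by linarith)
  refine ⟨div_nonneg (Real.log_nonneg (by linarith)) hlog, div_le_one_of_le₀ ?_ hlog⟩
  gcongr
  exact mul_le_of_le_one_left hs hx.2

theorem comp_const_mul_isLittleO_sq {g : ℝ → ℝ} (hg : g =o[𝓝 0] fun s => s ^ 2) (x : ℝ) :
    (fun s => g (x * s)) =o[𝓝 0] fun s => s ^ 2 := by
  have hx : Tendsto (fun s => x * s) (𝓝 0) (𝓝 0) := by
    simpa using (tendsto_id (x := 𝓝 (0 : ℝ))).const_mul x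
  refine (hg.comp_tendsto hx).trans_isBigO ?_
  simpa only [Function.comp_def, mul_pow] using
    isBigO_const_mul_self (x ^ 2) (fun s : ℝ => s ^ 2) (𝓝 0)

theorem log_one_add_sub_isLittleO_sq :
    (fun s : ℝ => Real.log (1 + s) - (s - s ^ 2 / 2)) =o[𝓝 0] fun s => s ^ 2 := by
  refine IsBigO.trans_isLittleO (g := fun s : ℝ => s ^ 3) ?_ (isLittleO_pow_pow (by norm_num))
  refine IsBigO.of_bound 2 ?_
  filter_upwards [Metric.closedBall_mem_nhds (0 : ℝ) one_half_pos] with s hs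
  have hs : |-s| ≤ 1 / 2 := by simpa using hs
  have hbound := Real.abs_log_sub_add_sum_range_le (x := -s) (by linarith) 2
  calc ‖Real.log (1 + s) - (s - s ^ 2 / 2)‖
      = |∑ i ∈ Finset.range 2, (-s) ^ (i + 1) / ((i : ℝ) + 1) + Real.log (1 - -s)| := by
        rw [Finset.sum_range_succ, Finset.sum_range_one, Nat.cast_zero, Nat.cast_one,
          Real.norm_eq_abs]
        ring_nf
    _ ≤ |-s| ^ 3 / (1 - |-s|) := hbound
    _ ≤ |-s| ^ 3 / (1 / 2) := by gcongr; linarith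
    _ = 2 * ‖s ^ 3‖ := by rw [abs_neg, norm_pow, Real.norm_eq_abs]; ring

theorem log_one_add_sub_one_sub_exp_neg_isLittleO_sq :
    (fun s : ℝ => Real.log (1 + s) - (1 - Real.exp (-s))) =o[𝓝 0] fun s => s ^ 2 := by
  have hexp := comp_const_mul_isLittleO_sq (Real.exp_sub_sum_range_succ_isLittleO_pow 2) (-1)
  refine (log_one_add_sub_isLittleO_sq.add hexp).congr_left fun s => ?_
  simp only [Finset.sum_range_succ, Finset.sum_range_zero, Nat.factorial_zero, Nat.factorial_one,
    Nat.factorial_two, Nat.cast_one, Nat.cast_ofNat, neg_one_mul]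
  ring

theorem tendsto_log_one_add_div : Tendsto (fun s : ℝ => Real.log (1 + s) / s) (𝓝[≠] 0) (𝓝 1) := by
  simpa [div_eq_inv_mul] using (Real.hasDerivAt_log one_ne_zero).tendsto_slope_zero

theorem eventually_log_one_add_ne_zero : ∀ᶠ s : ℝ in 𝓝[≠] 0, Real.log (1 + s) ≠ 0 := by
  filter_upwards [tendsto_log_one_add_div.eventually_ne one_ne_zero] with s hs hlog
  simp [hlog] at hs

theorem tendsto_logRatio_sub_div (x : ℝ) :
    Tendsto (fun s => (logRatio x s - x) / s) (𝓝[≠] 0) (𝓝 (x * (1 - x) / 2)) := by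
  have hnum : (fun s => Real.log (1 + x * s) - x * Real.log (1 + s) - x * (1 - x) / 2 * s ^ 2)
      =o[𝓝 0] fun s => s ^ 2 := by
    refine ((comp_const_mul_isLittleO_sq log_one_add_sub_isLittleO_sq x).sub
      (log_one_add_sub_isLittleO_sq.const_mul_left x)).congr_left fun s => ?_
    ring
  have hlim := ((hnum.tendsto_div_nhds_zero.mono_left nhdsWithin_le_nhds).add_const
    (x * (1 - x) / 2)).div tendsto_log_one_add_div one_ne_zero
  rw [zero_add, div_one] at hlim
  refine hlim.congr' ?_
  filter_upwards [self_mem_nhdsWithin, eventually_log_one_add_ne_zero] with s (hs : s ≠ 0) hlog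
  simp only [Pi.div_apply, logRatio]
  field_simp
  ring

theorem tendsto_logRatio (x : ℝ) : Tendsto (logRatio x) (𝓝[≠] 0) (𝓝 x) := by
  have hid : Tendsto id (𝓝[≠] (0 : ℝ)) (𝓝 0) := nhdsWithin_le_nhds
  have hlim := ((tendsto_logRatio_sub_div x).mul hid).add_const x
  rw [mul_zero, zero_add] at hlim
  refine hlim.congr' ?_
  filter_upwards [self_mem_nhdsWithin] with s (hs : s ≠ 0)
  rw [id, div_mul_cancel₀ _ hs, sub_add_cancel]

theorem logRatio_mul_one_sub_exp_neg_isLittleO (x : ℝ) :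
    (fun s => logRatio x s * (1 - Real.exp (-s)) - (1 - Real.exp (-(x * s)))) =o[𝓝[≠] 0]
      fun s => s ^ 2 := by
  have hlog := log_one_add_sub_one_sub_exp_neg_isLittleO_sq
  have hratio := ((tendsto_logRatio x).isBigO_one ℝ).mul_isLittleO (hlog.mono nhdsWithin_le_nhds)
  simp only [one_mul] at hratio
  refine (((comp_const_mul_isLittleO_sq hlog x).mono nhdsWithin_le_nhds).sub hratio).congr' ?_ .rfl
  filter_upwards [eventually_log_one_add_ne_zero] with s hs
  rw [mul_sub, logRatio, div_mul_cancel₀ _ hs]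
  ring

end LogRatio

section ExpSolution

variable {c : ℝ}

/-- The general solution `A + B exp (-x / c)` of the equation `g' + c g'' = 0`. -/
noncomputable def expSolution (c A B x : ℝ) : ℝ := A + B * Real.exp (-x / c)

theorem contDiff_expSolution (c A B : ℝ) {m : WithTop ℕ∞} : ContDiff ℝ m (expSolution c A B) := by
  unfold expSolution
  fun_prop

theorem continuous_expSolution (c A B : ℝ) : Continuous (expSolution c A B) :=
  (contDiff_expSolution c A B (m := 0)).continuous

theorem deriv_expSolution (c A B : ℝ) :
    deriv (expSolution c A B) = expSolution c 0 (-B / c) := by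
  ext x
  have hexp : HasDerivAt (fun y => Real.exp (-y / c)) (Real.exp (-x / c) * (-1 / c)) x :=
    ((hasDerivAt_neg x).div_const c).exp
  refine ((hexp.const_mul B).const_add A).deriv.trans ?_
  rw [expSolution]
  ring

theorem deriv_add_mul_deriv_deriv_expSolution (hc : c ≠ 0) (A B x : ℝ) :
    deriv (expSolution c A B) x + c * deriv (deriv (expSolution c A B)) x = 0 := by
  simp only [deriv_expSolution, expSolution]
  field_simp
  ring

theorem exists_eqOn_expSolution (hc : c ≠ 0) {s : Set ℝ} (hs : IsOpen s) (hs' : IsPreconnected s)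
    {g : ℝ → ℝ} (hg : DifferentiableOn ℝ g s) (hg' : DifferentiableOn ℝ (deriv g) s)
    (hode : ∀ x ∈ s, deriv g x + c * deriv (deriv g) x = 0) :
    ∃ A B, EqOn g (expSolution c A B) s := by
  have hderiv {x : ℝ} (hx : x ∈ s) : HasDerivAt g (deriv g x) x :=
    (hg.differentiableAt (hs.mem_nhds hx)).hasDerivAt
  have hderiv' {x : ℝ} (hx : x ∈ s) : HasDerivAt (deriv g) (deriv (deriv g) x) x :=
    (hg'.differentiableAt (hs.mem_nhds hx)).hasDerivAt
  have exists_const {F : ℝ → ℝ} (hF : ∀ x ∈ s, HasDerivAt F 0 x) : ∃ C, ∀ x ∈ s, F x = C :=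
    hs.exists_is_const_of_deriv_eq_zero hs'
      (fun x hx => (hF x hx).differentiableAt.differentiableWithinAt) fun x hx => (hF x hx).deriv
  obtain ⟨A, hA⟩ : ∃ A, ∀ x ∈ s, g x + c * deriv g x = A := exists_const fun x hx =>
    ((hderiv hx).add ((hderiv' hx).const_mul c)).congr_deriv (hode x hx)
  obtain ⟨B, hB⟩ : ∃ B, ∀ x ∈ s, (g x - A) * Real.exp (x / c) = B := exists_const fun x hx => by
    refine (((hderiv hx).sub_const A).mul ((hasDerivAt_id x).div_const c).exp).congr_deriv ?_
    rw [← hA x hx, id]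
    field_simp
    ring
  refine ⟨A, B, fun x hx => ?_⟩
  rw [expSolution, ← hB x hx, mul_assoc, ← Real.exp_add, neg_div, add_neg_cancel, Real.exp_zero]
  ring

theorem exists_expSolution_eq_and_eq (hc : c ≠ 0) {x y : ℝ} (hxy : x ≠ y) (a b : ℝ) :
    ∃ A B, expSolution c A B x = a ∧ expSolution c A B y = b := by
  have hexp : Real.exp (-x / c) - Real.exp (-y / c) ≠ 0 := by
    rw [sub_ne_zero, Real.exp_injective.ne_iff, ne_eq, div_left_inj' hc, neg_inj]
    exact hxy
  let B := (a - b) / (Real.exp (-x / c) - Real.exp (-y / c))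
  have hB : B * (Real.exp (-x / c) - Real.exp (-y / c)) = a - b := div_mul_cancel₀ _ hexp
  refine ⟨a - B * Real.exp (-x / c), B, sub_add_cancel _ _, ?_⟩
  rw [expSolution]
  linear_combination -hB

end ExpSolution

section Superconvergence

variable {μ x : ℝ} {g h : ℝ → ℝ}

theorem node_eq_logRatio (hμ : -1 < μ) (n : ℕ) (hx : 0 ≤ x) :
    node μ n x = logRatio x ((1 + μ) * n)⁻¹ := by
  have hc : 0 < 1 + μ := by linarith
  have hlog (y : ℝ) (hy : 0 ≤ y) :
      Real.log (1 + μ + y / n) - Real.log (1 + μ) = Real.log (1 + y * ((1 + μ) * n)⁻¹) := by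
    rw [← Real.log_div (by positivity) hc.ne', add_div, div_self hc.ne', mul_inv]
    ring_nf
  rw [node, hlog x hx, hlog 1 zero_le_one, one_mul, logRatio]

theorem node_mem_Icc (hμ : -1 < μ) (n : ℕ) (hx : x ∈ Icc (0 : ℝ) 1) :
    node μ n x ∈ Icc (0 : ℝ) 1 := by
  have hc : 0 < 1 + μ := by linarith
  rw [node_eq_logRatio hμ n hx.1]
  exact logRatio_mem_Icc hx (by positivity)

theorem tendsto_inv_mul_natCast {c : ℝ} (hc : 0 < c) :
    Tendsto (fun n : ℕ => (c * n)⁻¹) atTop (𝓝[≠] 0) :=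
  (tendsto_inv_atTop_nhdsGT_zero.comp
    (tendsto_natCast_atTop_atTop.const_mul_atTop hc)).mono_right (nhdsGT_le_nhdsNE 0)

theorem tendsto_natCast_mul_node_sub (hμ : -1 < μ) (hx : 0 ≤ x) :
    Tendsto (fun n : ℕ => n * (node μ n x - x)) atTop (𝓝 (x * (1 - x) / 2 / (1 + μ))) := by
  have hc : 0 < 1 + μ := by linarith
  refine (((tendsto_logRatio_sub_div x).comp (tendsto_inv_mul_natCast hc)).div_const _).congr
    fun n => ?_
  rw [node_eq_logRatio hμ n hx, Function.comp_apply, div_inv_eq_mul]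
  field_simp

/-- At the point `x`, the Bernstein sums of `g` at the nodes `a_n(x)` converge to `g x` with an
error `o(1/n)`, faster than the generic rate `1/n`. -/
def SuperconvergesAt (μ : ℝ) (g : ℝ → ℝ) (x : ℝ) : Prop :=
  (fun n : ℕ => bernsteinSum n (node μ n x) g - g x) =o[atTop] fun n : ℕ => (n : ℝ)⁻¹

theorem SuperconvergesAt.add (hg : SuperconvergesAt μ g x) (hh : SuperconvergesAt μ h x) :
    SuperconvergesAt μ (g + h) x :=
  (IsLittleO.add hg hh).congr_left fun n => by rw [map_add, Pi.add_apply]; ring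

theorem SuperconvergesAt.const_smul (hg : SuperconvergesAt μ g x) (a : ℝ) :
    SuperconvergesAt μ (a • g) x :=
  (IsLittleO.const_mul_left hg a).congr_left fun n => by
    rw [map_smul, Pi.smul_apply, smul_eq_mul, smul_eq_mul, mul_sub]

theorem SuperconvergesAt.congr (hg : SuperconvergesAt μ g x) (hgh : EqOn g h (Icc 0 1))
    (hx : x ∈ Icc (0 : ℝ) 1) : SuperconvergesAt μ h x :=
  IsLittleO.congr_left hg fun n => by rw [bernsteinSum_congr hgh, hgh hx]

theorem superconvergesAt_const (μ x a : ℝ) : SuperconvergesAt μ (fun _ => a) x := by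
  simp [SuperconvergesAt, bernsteinSum_const]

theorem pow_sub_pow_isLittleO_inv {p q : ℕ → ℝ} (hp : ∀ n, |p n| ≤ 1) (hq : ∀ n, |q n| ≤ 1)
    (hpq : (fun n => p n - q n) =o[atTop] fun n : ℕ => (n : ℝ)⁻¹ ^ 2) :
    (fun n => p n ^ n - q n ^ n) =o[atTop] fun n : ℕ => (n : ℝ)⁻¹ := by
  have hpow (n : ℕ) : |p n ^ n - q n ^ n| ≤ n * |p n - q n| :=
    calc |p n ^ n - q n ^ n| ≤ |p n - q n| * n * max |p n| |q n| ^ (n - 1) :=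
          abs_pow_sub_pow_le ..
      _ ≤ |p n - q n| * n * 1 := by
          gcongr
          exact pow_le_one₀ (le_max_of_le_left (abs_nonneg _)) (max_le (hp n) (hq n))
      _ = n * |p n - q n| := by ring
  have hmul : (fun n : ℕ => (n : ℝ) * (p n - q n)) =o[atTop] fun n : ℕ => (n : ℝ)⁻¹ := by
    refine ((isBigO_refl (fun n : ℕ => (n : ℝ)) atTop).mul_isLittleO hpq).congr_right fun n => ?_
    rcases eq_or_ne (n : ℝ) 0 with hn | hn
    · simp [hn]
    · field_simp
  refine (IsBigO.of_bound 1 (Eventually.of_forall fun n => ?_)).trans_isLittleO hmul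
  simpa using hpow n

theorem superconvergesAt_exp (hμ : -1 < μ) (hx : x ∈ Icc (0 : ℝ) 1) :
    SuperconvergesAt μ (fun y => Real.exp (-y / (1 + μ))) x := by
  have hc : 0 < 1 + μ := by linarith
  let s (n : ℕ) : ℝ := ((1 + μ) * n)⁻¹
  let p (n : ℕ) : ℝ := 1 - node μ n x * (1 - Real.exp (-s n))
  let q (n : ℕ) : ℝ := Real.exp (-(x * s n))
  have hs (n : ℕ) : 0 ≤ s n := by positivity
  have hp (n : ℕ) : |p n| ≤ 1 := by
    have ha := node_mem_Icc hμ n hx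
    have he : Real.exp (-s n) ≤ 1 := Real.exp_le_one_iff.2 (by linarith [hs n])
    rw [abs_le]
    constructor <;> nlinarith [ha.1, ha.2, Real.exp_pos (-s n)]
  have hq (n : ℕ) : |q n| ≤ 1 := by
    rw [Real.abs_exp, Real.exp_le_one_iff]
    linarith [mul_nonneg hx.1 (hs n)]
  have hpq : (fun n => p n - q n) =o[atTop] fun n : ℕ => (n : ℝ)⁻¹ ^ 2 := by
    have hsq : (fun n => s n ^ 2) =O[atTop] fun n : ℕ => (n : ℝ)⁻¹ ^ 2 := by
      simpa only [s, mul_inv, mul_pow] using isBigO_const_mul_self _ _ atTop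
    refine (((logRatio_mul_one_sub_exp_neg_isLittleO x).comp_tendsto
      (tendsto_inv_mul_natCast hc)).neg_left.trans_isBigO hsq).congr_left fun n => ?_
    simp only [p, q, s, node_eq_logRatio hμ n hx.1, Function.comp_apply]
    ring
  refine (pow_sub_pow_isLittleO_inv hp hq hpq).congr' ?_ .rfl
  filter_upwards [eventually_ne_atTop 0] with n hn
  have hn' : (n : ℝ) ≠ 0 := Nat.cast_ne_zero.2 hn
  rw [bernsteinSum_exp_neg_div, ← Real.exp_nat_mul]
  congr 2
  simp only [s]
  field_simp

theorem superconvergesAt_expSolution (hμ : -1 < μ) (hx : x ∈ Icc (0 : ℝ) 1) (A B : ℝ) :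
    SuperconvergesAt μ (expSolution (1 + μ) A B) x :=
  (superconvergesAt_const μ x A).add ((superconvergesAt_exp hμ hx).const_smul B)

theorem exists_pos_mul_inv_le_bernsteinSum_id_sub (hμ : -1 < μ) (hx : x ∈ Ioo (0 : ℝ) 1) :
    ∃ c > 0, ∀ᶠ n : ℕ in atTop, c * (n : ℝ)⁻¹ ≤ bernsteinSum n (node μ n x) id - id x := by
  have hlim : 0 < x * (1 - x) / 2 / (1 + μ) := by
    have hx0 : 0 < x := hx.1
    have hx1 : 0 < 1 - x := sub_pos.2 hx.2
    have hc : 0 < 1 + μ := by linarith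
    positivity
  refine ⟨_, half_pos hlim, ?_⟩
  filter_upwards [eventually_gt_atTop 0, (tendsto_natCast_mul_node_sub hμ hx.1.le).eventually
    (eventually_ge_nhds (half_lt_self hlim))] with n hn hle
  have hn' : (0 : ℝ) < n := Nat.cast_pos.2 hn
  rw [bernsteinSum_id hn.ne', id, ← div_eq_mul_inv, div_le_iff₀' hn']
  exact hle

theorem eqOn_of_superconvergesAt (hμ : -1 < μ) (hg : ContinuousOn g (Icc 0 1))
    (hh : ContinuousOn h (Icc 0 1)) (hgs : ∀ x ∈ Ioo (0 : ℝ) 1, SuperconvergesAt μ g x)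
    (hhs : ∀ x ∈ Ioo (0 : ℝ) 1, SuperconvergesAt μ h x) (h0 : g 0 = h 0) (h1 : g 1 = h 1) :
    EqOn g h (Icc 0 1) := by
  refine eqOn_of_isLittleO_of_eqOn_sdiff (L := fun n x => bernsteinSum n (node μ n x))
    isCompact_Icc (fun n x hx p hp => bernsteinSum_le (node_mem_Icc hμ n hx) hp) ?_ continuousOn_id
    (fun x hx => exists_pos_mul_inv_le_bernsteinSum_id_sub hμ hx) hg hh hgs hhs ?_
  · filter_upwards [eventually_gt_atTop 0] with n hn
    positivity
  · rw [Icc_sdiff_Ioo_same zero_le_one]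
    rintro x (rfl | rfl)
    exacts [h0, h1]

theorem forall_superconvergesAt_iff (hμ : -1 < μ) (hg : ContinuousOn g (Icc 0 1)) :
    (∀ x ∈ Ioo (0 : ℝ) 1, SuperconvergesAt μ g x) ↔
      ∃ A B, EqOn g (expSolution (1 + μ) A B) (Icc 0 1) := by
  constructor
  · intro hgs
    have hc : 1 + μ ≠ 0 := by linarith
    obtain ⟨A, B, h0, h1⟩ := exists_expSolution_eq_and_eq hc zero_ne_one (g 0) (g 1)
    exact ⟨A, B, eqOn_of_superconvergesAt hμ hg (continuous_expSolution _ A B).continuousOn hgs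
      (fun x hx => superconvergesAt_expSolution hμ (Ioo_subset_Icc_self hx) A B) h0.symm h1.symm⟩
  · rintro ⟨A, B, hAB⟩ x hx
    have hx' := Ioo_subset_Icc_self hx
    exact (superconvergesAt_expSolution hμ hx' A B).congr hAB.symm hx'

end Superconvergence

section Quotient

variable {μ x : ℝ} {f : ℝ → ℝ}

theorem lnMu_pos (hμ : 0 < μ) (hx : 0 ≤ x) : 0 < lnMu μ x :=
  Real.log_pos (by linarith)

theorem contDiffOn_lnMu {m : WithTop ℕ∞} {s : Set ℝ} (hs : ∀ x ∈ s, 1 + μ + x ≠ 0) :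
    ContDiffOn ℝ m (lnMu μ) s :=
  ContDiffOn.log (by fun_prop) hs

theorem continuousOn_quot (hμ : 0 < μ) (hf : ContinuousOn f (Icc 0 1)) :
    ContinuousOn (quot μ f) (Icc 0 1) :=
  hf.div (contDiffOn_lnMu (m := 0) fun x hx => by linarith [hx.1]).continuousOn
    fun _ hx => (lnMu_pos hμ hx.1).ne'

theorem isClassicalSolution_of_eqOn (hμ : 0 < μ) {A B : ℝ}
    (h : EqOn (quot μ f) (expSolution (1 + μ) A B) (Ioo 0 1)) : IsClassicalSolution μ f := by
  constructor
  · refine ((contDiff_expSolution (1 + μ) A B).contDiffOn.mul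
      (contDiffOn_lnMu (μ := μ) fun x hx => by linarith [hx.1])).congr fun x hx => ?_
    rw [← h hx, quot, div_mul_cancel₀ _ (lnMu_pos hμ hx.1.le).ne']
  · intro x hx
    rw [h.deriv isOpen_Ioo hx, (h.deriv isOpen_Ioo).deriv isOpen_Ioo hx]
    exact deriv_add_mul_deriv_deriv_expSolution (by linarith) A B x

theorem IsClassicalSolution.exists_eqOn (hμ : 0 < μ) (h : IsClassicalSolution μ f) :
    ∃ A B, EqOn (quot μ f) (expSolution (1 + μ) A B) (Ioo 0 1) := by
  have hquot : ContDiffOn ℝ 2 (quot μ f) (Ioo 0 1) :=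
    h.1.div (contDiffOn_lnMu fun x hx => by linarith [hx.1]) fun x hx => (lnMu_pos hμ hx.1.le).ne'
  have hderiv : ContDiffOn ℝ 1 (deriv (quot μ f)) (Ioo 0 1) :=
    hquot.deriv_of_isOpen isOpen_Ioo (by norm_num)
  exact exists_eqOn_expSolution (by linarith) isOpen_Ioo isPreconnected_Ioo
    (hquot.differentiableOn two_ne_zero) (hderiv.differentiableOn one_ne_zero) h.2

theorem isClassicalSolution_iff (hμ : 0 < μ) (hf : ContinuousOn f (Icc 0 1)) :
    IsClassicalSolution μ f ↔ ∃ A B, EqOn (quot μ f) (expSolution (1 + μ) A B) (Icc 0 1) := by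
  constructor
  · intro h
    obtain ⟨A, B, hAB⟩ := h.exists_eqOn hμ
    exact ⟨A, B, hAB.of_subset_closure (continuousOn_quot hμ hf)
      (continuous_expSolution _ A B).continuousOn Ioo_subset_Icc_self
      (closure_Ioo zero_ne_one).ge⟩
  · rintro ⟨A, B, hAB⟩
    exact isClassicalSolution_of_eqOn hμ (hAB.mono Ioo_subset_Icc_self)

theorem logOp_eq_lnMu_mul_bernsteinSum (μ : ℝ) (n : ℕ) (f : ℝ → ℝ) (x : ℝ) :
    logOp μ n f x = lnMu μ x * bernsteinSum n (node μ n x) (quot μ f) := by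
  simp [logOp, bernsteinSum_apply, quot, div_eq_mul_inv, mul_comm]

theorem logOp_sub_isLittleO_iff (hx : lnMu μ x ≠ 0) :
    (fun n : ℕ => |logOp μ n f x - f x|) =o[atTop] (fun n : ℕ => (n : ℝ)⁻¹) ↔
      SuperconvergesAt μ (quot μ f) x := by
  have herror (n : ℕ) : logOp μ n f x - f x =
      lnMu μ x * (bernsteinSum n (node μ n x) (quot μ f) - quot μ f x) := by
    rw [logOp_eq_lnMu_mul_bernsteinSum, mul_sub, quot, mul_div_cancel₀ _ hx]
  simp only [isLittleO_abs_left, herror, isLittleO_const_mul_left_iff hx, SuperconvergesAt]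

theorem quot_eq_expSolution_iff (hx : lnMu μ x ≠ 0) (A B : ℝ) :
    quot μ f x = expSolution (1 + μ) A B x ↔
      f x = A * lnMu μ x + B * lnMu μ x * Real.exp (-x / (1 + μ)) := by
  rw [quot, div_eq_iff hx, expSolution, add_mul, mul_right_comm]

end Quotient

end LogBernstein

theorem mainTheorem2 (μ : ℝ) (hμ : 0 < μ) (f : ℝ → ℝ) (hf : ContinuousOn f (Set.Icc 0 1)) :
    ((∀ x ∈ Set.Ioo (0 : ℝ) 1,
        (fun n : ℕ => |LogBernstein.logOp μ n f x - f x|) =o[Filter.atTop]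
          (fun n : ℕ => ((n : ℝ))⁻¹)) ↔
      LogBernstein.IsClassicalSolution μ f) ∧
    (LogBernstein.IsClassicalSolution μ f ↔
      ∃ A B : ℝ, ∀ x ∈ Set.Icc (0 : ℝ) 1,
        f x = A * LogBernstein.lnMu μ x +
          B * LogBernstein.lnMu μ x * Real.exp (-x / (1 + μ))) := by
  have hln {x : ℝ} (hx : 0 ≤ x) : LogBernstein.lnMu μ x ≠ 0 := (LogBernstein.lnMu_pos hμ hx).ne'
  have hsol := LogBernstein.isClassicalSolution_iff hμ hf
  constructor
  · rw [hsol, ← LogBernstein.forall_superconvergesAt_iff (by linarith)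
      (LogBernstein.continuousOn_quot hμ hf)]
    exact forall₂_congr fun x hx => LogBernstein.logOp_sub_isLittleO_iff (hln hx.1.le)
  · rw [hsol]
    exact exists₂_congr fun A B => forall₂_congr fun x hx =>
      LogBernstein.quot_eq_expSolution_iff (hln hx.1) A B
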